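/- Let $E$ be a separable (real) Banach space and let $A:D(A)\to E$ be a densely defined linear operator such that $-A$ is the infinitesimal generator of a $C_0$ semigroup $\{S_A(t)\}_{t\ge 0}$ of bounded linear operators on $E$ with $\|S_A(t)\|\le e^{-\omega t}$ for all $t\ge 0$, for some $\omega>0$. Let $T>0$ and let $F:[0,T]\times E\to E$ be continuous and such that: (i) for every $x\in E$ there are $\delta_x>0$, $L_x>0$ with $\|F(t,x_1)-F(t,x_2)\|\le L_x\|x_1-x_2\|$ for all $x_1,x_2\in B(x,\delta_x)$ and $t\in[0,T]$; (ii) there is $c>0$ with $\|F(t,x)\|\le c(1+\|x\|)$ for all $t\in[0,T]$, $x\in E$; (iii) there is $k\in[0,\omega)$ with $\beta(F([0,T]\times\Omega))\le k\,\beta(\Omega)$ for every bounded $\Omega\subset E$, where $\beta$ is the Hausdorff measure of noncompactness, i.e. $\beta(\Omega)$ is the infimum of all $r>0$ such that $\Omega$ can be covered by finitely many balls of $E$ of radius $r$. For $\lambda\ge 0$ consider $\dot u=-\lambda Au+\lambda F(t,u)$ on $[0,T]$. The mild solution of this equation with $u(0)=x$ is the (unique) continuous $u:[0,T]\to E$ with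 $$u(t)=S_A(\lambda t)x+\lambda\int_0^t S_A(\lambda(t-s))F(s,u(s))\,ds,\qquad t\in[0,T],$$ and $(x,\lambda)\in E\times[0,\infty)$ is called a $T$-periodic point if this solution satisfies $u(0)=u(T)$. Let $U\subset E$ be open and bounded, and let $x_0\in\overline U$ be a branching point, i.e. there is a sequence of $T$-periodic points $(x_n,\lambda_n)\in\overline U\times(0,\infty)$ converging to $(x_0,0)$. Then $x_0\in D(A)$ and $$-Ax_0+\widehat F(x_0)=0,\qquad\text{where}\quad \widehat F(x):=\frac1T\int_0^T F(t,x)\,dt .$$ -/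

import Mathlib

open Set Filter Topology MeasureTheory

noncomputable section

/-- `S` is a `C₀` semigroup of bounded linear operators on `E`. Only the operators `S t` with
`0 ≤ t` matter. -/
structure IsC0Semigroup {E : Type*} [NormedAddCommGroup E] [NormedSpace ℝ E]
    (S : ℝ → E →L[ℝ] E) : Prop where
  map_zero : S 0 = ContinuousLinearMap.id ℝ E
  map_add : ∀ s t : ℝ, 0 ≤ s → 0 ≤ t → S (s + t) = (S s).comp (S t)
  tendsto_zero : ∀ x : E, Tendsto (fun t : ℝ => S t x) (𝓝[>] 0) (𝓝 x)

/-- `B` is the infinitesimal generator of the `C₀` semigroup `S`: a point `x` lies in the domain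
of `B` and `B x = y` if and only if `(S t x - x) / t → y` as `t → 0⁺`. -/
structure IsInfinitesimalGenerator {E : Type*} [NormedAddCommGroup E] [NormedSpace ℝ E]
    (B : E →ₗ.[ℝ] E) (S : ℝ → E →L[ℝ] E) : Prop where
  semigroup : IsC0Semigroup S
  generator : ∀ x y : E, (∃ h : x ∈ B.domain, B ⟨x, h⟩ = y) ↔
    Tendsto (fun t : ℝ => t⁻¹ • (S t x - x)) (𝓝[>] 0) (𝓝 y)

/-- The Hausdorff measure of noncompactness: the infimum of all `r > 0` such that `Ω` can be
covered by finitely many balls of `E` of radius `r` (it is `∞` if `Ω` is unbounded). -/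
def hausdorffMNC {E : Type*} [NormedAddCommGroup E] (Ω : Set E) : ENNReal :=
  sInf (ENNReal.ofReal '' {r : ℝ | 0 < r ∧
    ∃ C : Set E, C.Finite ∧ Ω ⊆ ⋃ c ∈ C, Metric.ball c r})

/-- `u` is a mild solution on `[0, T]` of `u' = B u + f (t, u)`, `u 0 = x`, where `B` is the
generator of the `C₀` semigroup `S`. -/
structure IsMildSolution {E : Type*} [NormedAddCommGroup E] [NormedSpace ℝ E]
    (S : ℝ → E →L[ℝ] E) (f : ℝ → E → E) (T : ℝ) (x : E) (u : ℝ → E) : Prop where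
  continuousOn : ContinuousOn u (Icc 0 T)
  initial : u 0 = x
  duhamel : ∀ t ∈ Icc (0 : ℝ) T,
    u t = S t x + ∫ s in (0 : ℝ)..t, S (t - s) (f s (u s))

/-- The semigroup `t ↦ S (l t)`. If `-A` generates `S` and `0 < l`, then it is the semigroup
generated by `-l A` (see `scaledSemigroup_generator`); for `l = 0` it is the trivial semigroup. -/
def scaledSemigroup {E : Type*} [NormedAddCommGroup E] [NormedSpace ℝ E]
    (S : ℝ → E →L[ℝ] E) (l : ℝ) : ℝ → E →L[ℝ] E :=
  fun t => S (l * t)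

theorem scaledSemigroup_generator {E : Type*} [NormedAddCommGroup E] [NormedSpace ℝ E]
    {A : E →ₗ.[ℝ] E} {S : ℝ → E →L[ℝ] E} (h : IsInfinitesimalGenerator (-A) S)
    {l : ℝ} (hl : 0 < l) :
    IsInfinitesimalGenerator (-(l • A)) (scaledSemigroup S l) := by
  have hlim : Tendsto (fun t : ℝ => l * t) (𝓝[>] 0) (𝓝[>] 0) := by
    refine tendsto_nhdsWithin_iff.2 ⟨?_, ?_⟩
    · have : Tendsto (fun t : ℝ => l * t) (𝓝 0) (𝓝 (l * 0)) :=
        (continuous_const.mul continuous_id).tendsto 0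
      rw [mul_zero] at this
      exact this.mono_left nhdsWithin_le_nhds
    · filter_upwards [self_mem_nhdsWithin] with t ht
      exact mul_pos hl ht
  have hlim' : Tendsto (fun t : ℝ => l⁻¹ * t) (𝓝[>] 0) (𝓝[>] 0) := by
    refine tendsto_nhdsWithin_iff.2 ⟨?_, ?_⟩
    · have : Tendsto (fun t : ℝ => l⁻¹ * t) (𝓝 0) (𝓝 (l⁻¹ * 0)) :=
        (continuous_const.mul continuous_id).tendsto 0
      rw [mul_zero] at this
      exact this.mono_left nhdsWithin_le_nhds
    · filter_upwards [self_mem_nhdsWithin] with t ht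
      exact mul_pos (inv_pos.2 hl) ht
  refine ⟨⟨?_, ?_, ?_⟩, ?_⟩
  · simp [scaledSemigroup, h.semigroup.map_zero]
  · intro s t hs ht
    simp only [scaledSemigroup, mul_add]
    exact h.semigroup.map_add _ _ (by positivity) (by positivity)
  · intro x
    exact (h.semigroup.tendsto_zero x).comp hlim
  · intro x y
    have key : (∃ hx : x ∈ (-(l • A)).domain, (-(l • A)) ⟨x, hx⟩ = y) ↔
        (∃ hx : x ∈ (-A).domain, (-A) ⟨x, hx⟩ = l⁻¹ • y) := by
      constructor
      · rintro ⟨hx, hy⟩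
        refine ⟨hx, ?_⟩
        rw [← hy]
        change -(A ⟨x, hx⟩) = l⁻¹ • -(l • A ⟨x, hx⟩)
        rw [smul_neg, inv_smul_smul₀ hl.ne']
      · rintro ⟨hx, hy⟩
        refine ⟨hx, ?_⟩
        have hy' : -(A ⟨x, hx⟩) = l⁻¹ • y := hy
        change -(l • A ⟨x, hx⟩) = y
        rw [← smul_neg, hy', smul_inv_smul₀ hl.ne']
    rw [key, h.generator]
    constructor
    · intro H
      have H2 := (H.comp hlim).const_smul l
      rw [smul_inv_smul₀ hl.ne'] at H2
      refine H2.congr fun t => ?_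
      simp only [Function.comp, scaledSemigroup, smul_smul, mul_inv]
      rw [← mul_assoc, mul_inv_cancel₀ hl.ne', one_mul]
    · intro H
      have H2 := (H.comp hlim').const_smul l⁻¹
      refine H2.congr fun t => ?_
      simp only [Function.comp, scaledSemigroup, smul_smul, mul_inv, inv_inv]
      rw [← mul_assoc, ← mul_assoc, inv_mul_cancel₀ hl.ne', mul_inv_cancel₀ hl.ne', one_mul, one_mul]

/-- `(x, l)` is a `T`-periodic point of `u' = -l A u + l F (t, u)`, where `-A` generates `S`:
the mild solution starting at `x` is at `x` again at time `T`. -/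
def IsTPeriodicPoint {E : Type*} [NormedAddCommGroup E] [NormedSpace ℝ E]
    (S : ℝ → E →L[ℝ] E) (F : ℝ → E → E) (T : ℝ) (x : E) (l : ℝ) : Prop :=
  ∃ u : ℝ → E,
    IsMildSolution (scaledSemigroup S l) (fun t y => l • F t y) T x u ∧ u 0 = u T

/-- `x₀` is a branching point in `closure U`: it is a limit of points `xs n` of `closure U` such
that `(xs n, ls n)` is `T`-periodic for some `ls n > 0` with `ls n → 0`. -/
def IsBranchingPoint {E : Type*} [NormedAddCommGroup E] [NormedSpace ℝ E]
    (S : ℝ → E →L[ℝ] E) (F : ℝ → E → E) (T : ℝ) (U : Set E) (x₀ : E) : Prop :=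
  x₀ ∈ closure U ∧ ∃ (xs : ℕ → E) (ls : ℕ → ℝ),
    (∀ n, xs n ∈ closure U ∧ 0 < ls n ∧ IsTPeriodicPoint S F T (xs n) (ls n)) ∧
    Tendsto (fun n => (xs n, ls n)) atTop (𝓝 (x₀, 0))

/-- The time average `x ↦ (1 / T) ∫₀ᵀ F (t, x) dt`. -/
def timeAverage {E : Type*} [NormedAddCommGroup E] [NormedSpace ℝ E]
    (F : ℝ → E → E) (T : ℝ) (x : E) : E :=
  (1 / T) • ∫ t in (0 : ℝ)..T, F t x

end

/-!
As `l → 0⁺`, mild solutions of `u' = -l A u + l F (t, u)` starting near `x₀` stay uniformly close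
to `x₀` on `[0, T]`: `F` is bounded on a neighbourhood of the compact set `[0, T] × {x₀}`, and until
a solution leaves it the Duhamel integral is `O(l)`. For a `T`-periodic solution starting at `x`,
the Duhamel formula at time `T` then reads
`(S (l T) x - x) / (l T) = -(1 / T) ∫₀ᵀ S (l (T - s)) (F (s, u s)) ds`, whose right-hand side tends
to minus the time average of `F` at `x₀`.

On the left the base point moves along with the step `r = l T`. Still, if `(S r x - x) / r → y` as
`r → 0⁺` and `x → x₀`, then `y` is the value of the generator at `x₀`: the mean over `[0, t]` of the
orbit of `(S r x - x) / r` is the difference quotient, with step `t`, of the mean over `[0, r]` of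
the orbit of `x`. In the limit `r → 0⁺`, the mean over `[0, t]` of the orbit of `y` equals
`(S t x₀ - x₀) / t`, and `t → 0⁺` gives the claim.
-/

section UniformConvergence

variable {α β γ : Type*} [TopologicalSpace α] [TopologicalSpace β] {f : α → β → γ}
  {s : Set α} {k : Set β} {q : α}

theorem tendstoUniformlyOn_comp_of_continuousOn [UniformSpace γ] (hk : IsCompact k)
    (hf : ContinuousOn f.uncurry (s ×ˢ k)) (hq : q ∈ s) {ι : Type*} {p : Filter ι}
    {v : ι → β → α} (hv : Tendsto v.uncurry (p ×ˢ 𝓟 k) (𝓝[s] q)) :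
    TendstoUniformlyOn (fun i b => f (v i b) b) (f q) p k := by
  intro V hV
  obtain ⟨W, hW, hWV⟩ := hk.mem_uniformity_of_prod hf hq (symm_le_uniformity hV)
  filter_upwards [eventually_prod_principal_iff.1 (hv.eventually_mem hW)] with i hi b hb
  exact hWV _ (hi b hb) b hb

theorem tendstoUniformlyOn_nhdsWithin_of_continuousOn [UniformSpace γ] (hk : IsCompact k)
    (hf : ContinuousOn f.uncurry (s ×ˢ k)) (hq : q ∈ s) :
    TendstoUniformlyOn f (f q) (𝓝[s] q) k :=
  tendstoUniformlyOn_comp_of_continuousOn hk hf hq (v := fun a _ => a) tendsto_fst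

theorem exists_eventually_forall_norm_le_of_continuousOn [SeminormedAddGroup γ]
    (hk : IsCompact k) (hf : ContinuousOn f.uncurry (s ×ˢ k)) (hq : q ∈ s) :
    ∃ C, ∀ᶠ a in 𝓝[s] q, ∀ b ∈ k, ‖f a b‖ ≤ C := by
  have hfq : ContinuousOn (f q) k :=
    hf.comp (f := fun b => (q, b)) (by fun_prop) fun b hb => ⟨hq, hb⟩
  obtain ⟨C, hC⟩ := hk.exists_bound_of_continuousOn hfq
  refine ⟨C + 1, ?_⟩
  exact (uniformContinuous_norm.comp_tendstoUniformlyOn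
    (tendstoUniformlyOn_nhdsWithin_of_continuousOn hk hf hq)).eventually_forall_le
      (lt_add_one C) hC

theorem continuousOn_intervalIntegral_of_continuousOn {X E : Type*} [TopologicalSpace X]
    [FirstCountableTopology X] [NormedAddCommGroup E] [NormedSpace ℝ E] {f : X → ℝ → E}
    {s : Set X} {a b : ℝ} (hf : ContinuousOn f.uncurry (s ×ˢ uIcc a b)) :
    ContinuousOn (fun x => ∫ t in a..b, f x t) s := by
  intro x hx
  refine TendstoUniformlyOn.tendsto_intervalIntegral_of_continuousOn ?_
    (tendstoUniformlyOn_nhdsWithin_of_continuousOn isCompact_uIcc hf hx)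
  filter_upwards [self_mem_nhdsWithin] with y hy
  exact hf.comp (f := fun t => (y, t)) (by fun_prop) fun t ht => ⟨hy, ht⟩

theorem mapsTo_Icc_of_forall_mapsTo_Ico {X : Type*} [TopologicalSpace X] {u : ℝ → X} {a b : ℝ}
    {V : Set X} (hu : ContinuousOn u (Icc a b)) (hV : IsOpen V)
    (hstep : ∀ t ∈ Icc a b, MapsTo u (Ico a t) V → u t ∈ V) : MapsTo u (Icc a b) V := by
  intro t ht
  by_contra htV
  have hexit : IsCompact (Icc a b ∩ u ⁻¹' Vᶜ) :=
    isCompact_Icc.of_isClosed_subset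
      (hu.preimage_isClosed_of_isClosed isClosed_Icc hV.isClosed_compl) inter_subset_left
  obtain ⟨t₀, ⟨ht₀, ht₀V⟩, hleast⟩ := hexit.exists_isLeast ⟨t, ht, htV⟩
  refine ht₀V (hstep t₀ ht₀ fun r hr => ?_)
  by_contra hrV
  exact (hleast ⟨⟨hr.1, hr.2.le.trans ht₀.2⟩, hrV⟩).not_gt hr.2

end UniformConvergence

section C0Semigroup

variable {E : Type*} [NormedAddCommGroup E] [NormedSpace ℝ E] {S : ℝ → E →L[ℝ] E}

namespace IsC0Semigroup

theorem tendsto_nhdsGE_zero (h : IsC0Semigroup S) (x : E) :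
    Tendsto (fun t => S t x) (𝓝[≥] 0) (𝓝 x) := by
  have hright : ContinuousWithinAt (fun t => S t x) (Ioi 0) 0 := by
    simpa [ContinuousWithinAt, h.map_zero] using h.tendsto_zero x
  simpa [ContinuousWithinAt, h.map_zero] using continuousWithinAt_Ioi_iff_Ici.1 hright

theorem map_add_apply (h : IsC0Semigroup S) {s t : ℝ} (hs : 0 ≤ s) (ht : 0 ≤ t) (x : E) :
    S (s + t) x = S s (S t x) := by
  rw [h.map_add s t hs ht, ContinuousLinearMap.comp_apply]

theorem apply_comm (h : IsC0Semigroup S) {s t : ℝ} (hs : 0 ≤ s) (ht : 0 ≤ t) (x : E) :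
    S s (S t x) = S t (S s x) := by
  rw [← h.map_add_apply hs ht, add_comm, h.map_add_apply ht hs]

theorem map_natCast_mul (h : IsC0Semigroup S) {t : ℝ} (ht : 0 ≤ t) (n : ℕ) :
    S (n * t) = S t ^ n := by
  induction n with
  | zero => rw [Nat.cast_zero, zero_mul, pow_zero, h.map_zero]; rfl
  | succ n ih =>
    rw [Nat.cast_succ, add_one_mul, h.map_add _ _ (by positivity) ht, ih, pow_succ]
    rfl

theorem norm_apply_sub_apply_le (h : IsC0Semigroup S) {M b : ℝ} (hM : ∀ t ∈ Icc 0 b, ‖S t‖ ≤ M)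
    {s t : ℝ} (hs : s ∈ Icc 0 b) (ht : t ∈ Icc 0 b) (x : E) :
    ‖S s x - S t x‖ ≤ M * ‖S |s - t| x - x‖ := by
  wlog hts : t ≤ s generalizing s t
  · rw [norm_sub_rev, abs_sub_comm]
    exact this ht hs (le_of_not_ge hts)
  have hdiff : 0 ≤ s - t := sub_nonneg.2 hts
  rw [abs_of_nonneg hdiff]
  calc ‖S s x - S t x‖ = ‖S t (S (s - t) x - x)‖ := by
        rw [map_sub, ← h.map_add_apply ht.1 hdiff, add_sub_cancel]
    _ ≤ M * ‖S (s - t) x - x‖ := (S t).le_of_opNorm_le (hM t ht) _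

section Complete

variable [CompleteSpace E]

theorem exists_eventually_opNorm_le (h : IsC0Semigroup S) :
    ∃ M, ∀ᶠ t in 𝓝[≥] (0 : ℝ), ‖S t‖ ≤ M := by
  by_contra! hunbdd
  have hlarge (n : ℕ) : ∃ t ∈ Ico (0 : ℝ) (1 / (n + 1)), n < ‖S t‖ := by
    have hfreq := (hunbdd n).and_eventually
      (Ico_mem_nhdsGE (Nat.one_div_pos_of_nat (α := ℝ) (n := n)))
    obtain ⟨t, hlt, ht⟩ := hfreq.exists
    exact ⟨t, ht, hlt⟩
  choose t ht hlt using hlarge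
  have ht_lim : Tendsto t atTop (𝓝[≥] 0) :=
    tendsto_nhdsWithin_iff.2 ⟨squeeze_zero (fun n => (ht n).1) (fun n => (ht n).2.le)
      tendsto_one_div_add_atTop_nhds_zero_nat, .of_forall fun n => (ht n).1⟩
  obtain ⟨C, hC⟩ : ∃ C, ∀ n, ‖S (t n)‖ ≤ C := banach_steinhaus fun x => by
    obtain ⟨C, hC⟩ := ((h.tendsto_nhdsGE_zero x).comp ht_lim).norm.bddAbove_range
    exact ⟨C, fun n => hC ⟨n, rfl⟩⟩
  obtain ⟨n, hn⟩ := exists_nat_gt C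
  exact (hlt n).not_ge ((hC n).trans hn.le)

theorem exists_forall_mem_Icc_opNorm_le (h : IsC0Semigroup S) (b : ℝ) :
    ∃ M, ∀ t ∈ Icc 0 b, ‖S t‖ ≤ M := by
  obtain ⟨M, hM⟩ := h.exists_eventually_opNorm_le
  obtain ⟨δ, hδ : 0 < δ, hδM⟩ := mem_nhdsGE_iff_exists_Ico_subset.1 hM
  obtain ⟨n, hn⟩ := exists_nat_gt (b / δ)
  refine ⟨M ^ n, fun t ht => ?_⟩
  have hn_pos : (0 : ℝ) < n := (div_nonneg (ht.1.trans ht.2) hδ.le).trans_lt hn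
  have hsmall : t / n ∈ Ico 0 δ := by
    refine ⟨div_nonneg ht.1 hn_pos.le, (div_lt_iff₀ hn_pos).2 (ht.2.trans_lt ?_)⟩
    rwa [div_lt_iff₀' hδ] at hn
  calc ‖S t‖ = ‖S (t / n) ^ n‖ := by
        rw [← h.map_natCast_mul hsmall.1, mul_div_cancel₀ t hn_pos.ne']
    _ ≤ ‖S (t / n)‖ ^ n := norm_pow_le' _ (by exact_mod_cast hn_pos)
    _ ≤ M ^ n := pow_le_pow_left₀ (norm_nonneg _) (hδM hsmall) n

theorem continuousOn_apply (h : IsC0Semigroup S) :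
    ContinuousOn (fun p : ℝ × E => S p.1 p.2) (Ici 0 ×ˢ univ) := by
  rintro ⟨t, x⟩ ⟨ht, -⟩
  obtain ⟨M, hM⟩ := h.exists_forall_mem_Icc_opNorm_le (t + 1)
  have hfst : Tendsto (fun p : ℝ × E => p.1) (𝓝[Ici 0 ×ˢ univ] (t, x)) (𝓝 t) :=
    continuous_fst.continuousWithinAt
  have hsnd : Tendsto (fun p : ℝ × E => p.2) (𝓝[Ici 0 ×ˢ univ] (t, x)) (𝓝 x) :=
    continuous_snd.continuousWithinAt
  have habs : Tendsto (fun p : ℝ × E => |p.1 - t|) (𝓝[Ici 0 ×ˢ univ] (t, x)) (𝓝[≥] 0) :=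
    tendsto_nhdsWithin_iff.2
      ⟨by simpa using (hfst.sub_const t).abs, .of_forall fun p => mem_Ici.2 (abs_nonneg _)⟩
  have hbound : Tendsto (fun p : ℝ × E => M * ‖p.2 - x‖ + M * ‖S |p.1 - t| x - x‖)
      (𝓝[Ici 0 ×ˢ univ] (t, x)) (𝓝 0) := by
    have hspace := tendsto_iff_norm_sub_tendsto_zero.1 hsnd
    have htime := tendsto_iff_norm_sub_tendsto_zero.1 ((h.tendsto_nhdsGE_zero x).comp habs)
    simpa using (hspace.const_mul M).add (htime.const_mul M)
  refine tendsto_iff_norm_sub_tendsto_zero.2 (squeeze_zero' (.of_forall fun _ => norm_nonneg _)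
    ?_ hbound)
  filter_upwards [self_mem_nhdsWithin, hfst.eventually_le_const (lt_add_one t)] with p hp hpt
  have hp_mem : p.1 ∈ Icc 0 (t + 1) := ⟨hp.1, hpt⟩
  calc ‖S p.1 p.2 - S t x‖ = ‖S p.1 (p.2 - x) + (S p.1 x - S t x)‖ := by
        rw [map_sub, sub_add_sub_cancel]
    _ ≤ ‖S p.1 (p.2 - x)‖ + ‖S p.1 x - S t x‖ := norm_add_le _ _
    _ ≤ M * ‖p.2 - x‖ + M * ‖S |p.1 - t| x - x‖ :=
      add_le_add ((S p.1).le_of_opNorm_le (hM _ hp_mem) _)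
        (h.norm_apply_sub_apply_le hM hp_mem ⟨ht, (lt_add_one t).le⟩ x)

theorem tendstoUniformlyOn_mul_add_dist (h : IsC0Semigroup S) (C T : ℝ) {ι : Type*}
    {p : Filter ι} {l : ι → ℝ} {x : ι → E} {x₀ : E} (hl : Tendsto l p (𝓝[≥] 0))
    (hx : Tendsto x p (𝓝 x₀)) :
    TendstoUniformlyOn (fun i t => l i * C * t + dist (S (l i * t) (x i)) x₀) (fun _ => 0) p
      (Icc 0 T) := by
  have hS : ContinuousOn (fun q : (ℝ × E) × ℝ => S (q.1.1 * q.2) q.1.2)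
      ((Ici 0 ×ˢ univ) ×ˢ Icc 0 T) :=
    h.continuousOn_apply.comp (f := fun q : (ℝ × E) × ℝ => (q.1.1 * q.2, q.1.2)) (by fun_prop)
      fun q hq => ⟨mul_nonneg hq.1.1 hq.2.1, mem_univ _⟩
  have hpair : Tendsto (fun i => (l i, x i)) p (𝓝[Ici 0 ×ˢ univ] (0, x₀)) := by
    rw [nhdsWithin_prod_eq, nhdsWithin_univ]
    exact hl.prodMk hx
  simpa [h.map_zero] using tendstoUniformlyOn_comp_of_continuousOn isCompact_Icc
    (f := fun (q : ℝ × E) t => q.1 * C * t + dist (S (q.1 * t) q.2) x₀)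
    (v := fun i _ => (l i, x i)) (ContinuousOn.add (by fun_prop)
      (continuous_dist.comp_continuousOn (hS.prodMk continuousOn_const)))
    ⟨self_mem_Ici, mem_univ _⟩ (hpair.comp tendsto_fst)

theorem intervalIntegrable_orbit (h : IsC0Semigroup S) (x : E) {a b : ℝ} (ha : 0 ≤ a)
    (hb : 0 ≤ b) : IntervalIntegrable (fun s => S s x) volume a b :=
  (h.continuousOn_apply.comp (f := fun s => (s, x)) (by fun_prop) fun _ hs =>
    ⟨(le_min ha hb).trans hs.1, mem_univ _⟩).intervalIntegrable

theorem apply_integral_orbit (h : IsC0Semigroup S) {r t : ℝ} (hr : 0 ≤ r) (ht : 0 ≤ t) (x : E) :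
    S t (∫ s in 0..r, S s x) = (∫ s in 0..t + r, S s x) - ∫ s in 0..t, S s x := by
  calc S t (∫ s in 0..r, S s x) = ∫ s in 0..r, S t (S s x) :=
        ((S t).intervalIntegral_comp_comm (h.intervalIntegrable_orbit x le_rfl hr)).symm
    _ = ∫ s in 0..r, S (t + s) x :=
        intervalIntegral.integral_congr fun s hs =>
          (h.map_add_apply ht ((le_min le_rfl hr).trans hs.1) x).symm
    _ = ∫ s in t..t + r, S s x := by
        rw [intervalIntegral.integral_comp_add_left (fun s => S s x) t, add_zero]
    _ = _ := (intervalIntegral.integral_interval_sub_left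
        (h.intervalIntegrable_orbit x le_rfl (add_nonneg ht hr))
        (h.intervalIntegrable_orbit x le_rfl ht)).symm

theorem integral_orbit_apply (h : IsC0Semigroup S) {r t : ℝ} (hr : 0 ≤ r) (ht : 0 ≤ t) (x : E) :
    ∫ s in 0..t, S s (S r x) = S r (∫ s in 0..t, S s x) := by
  rw [← (S r).intervalIntegral_comp_comm (h.intervalIntegrable_orbit x le_rfl ht)]
  exact intervalIntegral.integral_congr fun s hs =>
    h.apply_comm ((le_min le_rfl ht).trans hs.1) hr x

end Complete

end IsC0Semigroup

/-- The mean of the orbit `s ↦ S s x` over `[0, r]`. Rescaling the interval of integration to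
`[0, 1]` gives the right value `x` at `r = 0`, so that the mean is continuous up to `r = 0`. -/
noncomputable def orbitMean (S : ℝ → E →L[ℝ] E) (r : ℝ) (x : E) : E :=
  ∫ σ in (0 : ℝ)..1, S (r * σ) x

theorem smul_orbitMean (S : ℝ → E →L[ℝ] E) (r : ℝ) (x : E) :
    r • orbitMean S r x = ∫ s in 0..r, S s x := by
  simpa [orbitMean] using
    intervalIntegral.smul_integral_comp_mul_left (a := 0) (b := 1) (fun s => S s x) r

namespace IsC0Semigroup

variable [CompleteSpace E]

theorem orbitMean_zero (h : IsC0Semigroup S) (x : E) : orbitMean S 0 x = x := by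
  simp [orbitMean, h.map_zero]

theorem continuousOn_orbitMean (h : IsC0Semigroup S) :
    ContinuousOn (fun p : ℝ × E => orbitMean S p.1 p.2) (Ici 0 ×ˢ univ) := by
  refine continuousOn_intervalIntegral_of_continuousOn
    (h.continuousOn_apply.comp (f := fun q : (ℝ × E) × ℝ => (q.1.1 * q.2, q.1.2)) (by fun_prop) ?_)
  rintro ⟨p, σ⟩ ⟨hp, hσ⟩
  rw [uIcc_of_le zero_le_one] at hσ
  exact ⟨mul_nonneg hp.1 hσ.1, mem_univ _⟩

theorem orbitMean_differenceQuotient (h : IsC0Semigroup S) {r t : ℝ} (hr : 0 < r) (ht : 0 < t)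
    (x : E) :
    orbitMean S t (r⁻¹ • (S r x - x)) = t⁻¹ • (S t (orbitMean S r x) - orbitMean S r x) := by
  have hcomm : ∫ s in 0..t, S s (S r x - x) =
      S t (∫ s in 0..r, S s x) - ∫ s in 0..r, S s x := by
    simp only [map_sub]
    rw [intervalIntegral.integral_sub (h.intervalIntegrable_orbit _ le_rfl ht.le)
      (h.intervalIntegrable_orbit _ le_rfl ht.le), h.integral_orbit_apply hr.le ht.le,
      h.apply_integral_orbit ht.le hr.le, h.apply_integral_orbit hr.le ht.le, add_comm r t,
      sub_right_comm]
  rw [eq_inv_smul_iff₀ ht.ne', smul_orbitMean]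
  simp only [map_smul, intervalIntegral.integral_smul]
  rw [hcomm, ← smul_orbitMean, map_smul, ← smul_sub, inv_smul_smul₀ hr.ne']

theorem tendsto_orbitMean (h : IsC0Semigroup S) {ι : Type*} {p : Filter ι} {a : ι → ℝ}
    {x : ι → E} {b : ℝ} {x₀ : E} (ha : Tendsto a p (𝓝[Ici 0] b)) (hb : 0 ≤ b)
    (hx : Tendsto x p (𝓝 x₀)) :
    Tendsto (fun i => orbitMean S (a i) (x i)) p (𝓝 (orbitMean S b x₀)) := by
  have hpair : Tendsto (fun i => (a i, x i)) p (𝓝[Ici 0 ×ˢ univ] (b, x₀)) := by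
    rw [nhdsWithin_prod_eq, nhdsWithin_univ]
    exact ha.prodMk hx
  exact (h.continuousOn_orbitMean (b, x₀) ⟨hb, mem_univ _⟩).tendsto.comp hpair

theorem tendsto_differenceQuotient (h : IsC0Semigroup S) {ι : Type*} {p : Filter ι} [p.NeBot]
    {r : ι → ℝ} {x : ι → E} {x₀ y : E} (hr : Tendsto r p (𝓝[>] 0)) (hx : Tendsto x p (𝓝 x₀))
    (hy : Tendsto (fun i => (r i)⁻¹ • (S (r i) (x i) - x i)) p (𝓝 y)) :
    Tendsto (fun t => t⁻¹ • (S t x₀ - x₀)) (𝓝[>] 0) (𝓝 y) := by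
  have hle : (𝓝[>] 0 : Filter ℝ) ≤ 𝓝[≥] 0 := nhdsWithin_mono 0 Ioi_subset_Ici_self
  have hmean : Tendsto (fun i => orbitMean S (r i) (x i)) p (𝓝 x₀) := by
    simpa only [h.orbitMean_zero] using h.tendsto_orbitMean (hr.mono_right hle) le_rfl hx
  have hquot {t : ℝ} (ht : 0 < t) : orbitMean S t y = t⁻¹ • (S t x₀ - x₀) := by
    refine tendsto_nhds_unique
      (h.tendsto_orbitMean (tendsto_const_nhdsWithin (mem_Ici.2 ht.le)) ht.le hy)
      (Tendsto.congr' ?_ (((((S t).continuous.tendsto x₀).comp hmean).sub hmean).const_smul t⁻¹))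
    filter_upwards [hr.eventually_mem self_mem_nhdsWithin] with i hi
    exact (h.orbitMean_differenceQuotient hi ht (x i)).symm
  have hlim := h.tendsto_orbitMean (tendsto_id'.2 hle) le_rfl (tendsto_const_nhds (x := y))
  rw [h.orbitMean_zero] at hlim
  refine hlim.congr' ?_
  filter_upwards [self_mem_nhdsWithin] with t ht
  exact hquot ht

end IsC0Semigroup

theorem IsMildSolution.mapsTo_of_closedBall_subset {f : ℝ → E → E} {T C : ℝ} {x : E} {u : ℝ → E}
    {V : Set E} (hu : IsMildSolution S f T x u) (hV : IsOpen V)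
    (hC : ∀ t ∈ Icc 0 T, ∀ s ∈ Ico 0 t, ∀ y ∈ V, ‖S (t - s) (f s y)‖ ≤ C)
    (hball : ∀ t ∈ Icc 0 T, Metric.closedBall (S t x) (C * t) ⊆ V) :
    MapsTo u (Icc 0 T) V := by
  refine mapsTo_Icc_of_forall_mapsTo_Ico hu.continuousOn hV fun t ht hmaps => hball t ht ?_
  have hint : ‖∫ s in 0..t, S (t - s) (f s (u s))‖ ≤ C * |t - 0| := by
    refine intervalIntegral.norm_integral_le_of_norm_le_const_ae ?_
    filter_upwards [Measure.ae_ne volume t] with s hst hs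
    rw [uIoc_of_le ht.1] at hs
    have hs_mem : s ∈ Ico 0 t := ⟨hs.1.le, lt_of_le_of_ne hs.2 hst⟩
    exact hC t ht s hs_mem (u s) (hmaps hs_mem)
  rw [sub_zero, abs_of_nonneg ht.1] at hint
  rwa [Metric.mem_closedBall, dist_eq_norm, hu.duhamel t ht, add_sub_cancel_left]

theorem IsMildSolution.inv_smul_sub_eq_neg_of_eq {F : ℝ → E → E} {T l : ℝ} {x : E} {u : ℝ → E}
    (hu : IsMildSolution (scaledSemigroup S l) (fun t y => l • F t y) T x u) (hT : 0 ≤ T)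
    (hl : l ≠ 0) (hper : u 0 = u T) :
    (l * T)⁻¹ • (S (l * T) x - x) =
      -((1 / T) • ∫ s in 0..T, S (l * (T - s)) (F s (u s))) := by
  have hduhamel : x = S (l * T) x + l • ∫ s in 0..T, S (l * (T - s)) (F s (u s)) := by
    simpa only [← hper, hu.initial, scaledSemigroup, map_smul, intervalIntegral.integral_smul]
      using hu.duhamel T ⟨hT, le_rfl⟩
  rw [← neg_sub x, sub_eq_of_eq_add' hduhamel, smul_neg, smul_smul, mul_inv_rev,
    inv_mul_cancel_right₀ hl, one_div]

section SmallParameter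

variable [CompleteSpace E] {F : ℝ → E → E} {T : ℝ} {ι : Type*} {p : Filter ι} {l : ι → ℝ}
  {x : ι → E} {u : ι → ℝ → E} {x₀ : E}

theorem tendstoUniformlyOn_of_isMildSolution (h : IsC0Semigroup S)
    (hF : ContinuousOn (fun p : ℝ × E => F p.1 p.2) (Icc 0 T ×ˢ univ))
    (hl : Tendsto l p (𝓝[≥] 0)) (hx : Tendsto x p (𝓝 x₀))
    (hu : ∀ i, IsMildSolution (scaledSemigroup S (l i)) (fun t y => l i • F t y) T (x i) (u i)) :
    TendstoUniformlyOn u (fun _ => x₀) p (Icc 0 T) := by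
  obtain ⟨M, hM⟩ := h.exists_forall_mem_Icc_opNorm_le T
  obtain ⟨C, hC⟩ : ∃ C, ∀ᶠ y in 𝓝 x₀, ∀ s ∈ Icc 0 T, ‖F s y‖ ≤ C := by
    simpa only [nhdsWithin_univ] using exists_eventually_forall_norm_le_of_continuousOn
      (f := fun y s => F s y) isCompact_Icc
      (hF.comp continuous_swap.continuousOn fun q hq => hq.symm) (mem_univ x₀)
  obtain ⟨δ, hδ, hCδ⟩ := Metric.eventually_nhds_iff_ball.1 hC
  have hradius := h.tendstoUniformlyOn_mul_add_dist (M * C) T hl hx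
  rw [Metric.tendstoUniformlyOn_iff]
  intro ε hε
  filter_upwards [Metric.tendstoUniformlyOn_iff.1 hradius _ (lt_min hε hδ),
    hl.eventually_mem (Icc_mem_nhdsGE zero_lt_one)] with i hi hl01 t ht
  have hmaps : MapsTo (u i) (Icc 0 T) (Metric.ball x₀ (min ε δ)) := by
    refine (hu i).mapsTo_of_closedBall_subset (C := l i * (M * C)) Metric.isOpen_ball ?_ ?_
    · intro t ht s hs y hy
      have htime : l i * (t - s) ∈ Icc 0 T := by
        have hts : t - s ∈ Icc 0 T := ⟨sub_nonneg.2 hs.2.le, by linarith [ht.2, hs.1]⟩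
        exact ⟨mul_nonneg hl01.1 hts.1, (mul_le_of_le_one_left hts.1 hl01.2).trans hts.2⟩
      rw [scaledSemigroup, map_smul, norm_smul, Real.norm_of_nonneg hl01.1]
      exact mul_le_mul_of_nonneg_left ((S _).le_of_opNorm_le_of_le (hM _ htime)
        (hCδ y (Metric.ball_subset_ball (min_le_right _ _) hy) s ⟨hs.1, hs.2.le.trans ht.2⟩))
        hl01.1
    · intro t ht
      refine Metric.closedBall_subset_ball' ?_
      have hdist := hi t ht
      rw [dist_zero_left, Real.norm_eq_abs] at hdist
      exact (le_abs_self _).trans_lt hdist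
  rw [dist_comm]
  exact (hmaps ht).trans_le (min_le_left _ _)

theorem tendsto_duhamel_integral [p.IsCountablyGenerated] (h : IsC0Semigroup S) (hT : 0 ≤ T)
    (hF : ContinuousOn (fun p : ℝ × E => F p.1 p.2) (Icc 0 T ×ˢ univ))
    (hl : Tendsto l p (𝓝[≥] 0)) (hu_cont : ∀ i, ContinuousOn (u i) (Icc 0 T))
    (hu : TendstoUniformlyOn u (fun _ => x₀) p (Icc 0 T)) :
    Tendsto (fun i => ∫ s in 0..T, S (l i * (T - s)) (F s (u i s))) p
      (𝓝 (∫ s in 0..T, F s x₀)) := by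
  have hf : ContinuousOn (fun q : (ℝ × E) × ℝ => S (q.1.1 * (T - q.2)) (F q.2 q.1.2))
      ((Ici 0 ×ˢ univ) ×ˢ Icc 0 T) := by
    have hFq : ContinuousOn (fun q : (ℝ × E) × ℝ => F q.2 q.1.2) ((Ici 0 ×ˢ univ) ×ˢ Icc 0 T) :=
      hF.comp (f := fun q : (ℝ × E) × ℝ => (q.2, q.1.2)) (by fun_prop)
        fun q hq => ⟨hq.2, mem_univ _⟩
    refine h.continuousOn_apply.comp (f := fun q : (ℝ × E) × ℝ => (q.1.1 * (T - q.2), F q.2 q.1.2))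
      (ContinuousOn.prodMk (by fun_prop) hFq) ?_
    exact fun q hq => ⟨mul_nonneg hq.1.1 (sub_nonneg.2 hq.2.2), mem_univ _⟩
  have hv : Tendsto (fun q : ι × ℝ => (l q.1, u q.1 q.2)) (p ×ˢ 𝓟 (Icc 0 T))
      (𝓝[Ici 0 ×ˢ univ] (0, x₀)) := by
    rw [nhdsWithin_prod_eq, nhdsWithin_univ]
    exact (hl.comp tendsto_fst).prodMk (tendsto_prod_principal_iff.2 hu)
  have hunif := tendstoUniformlyOn_comp_of_continuousOn
    (f := fun (q : ℝ × E) s => S (q.1 * (T - s)) (F s q.2)) (v := fun i s => (l i, u i s))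
    isCompact_Icc hf ⟨self_mem_Ici, mem_univ _⟩ hv
  simp only [zero_mul, h.map_zero, ContinuousLinearMap.id_apply] at hunif
  rw [← uIcc_of_le hT] at hunif
  refine hunif.tendsto_intervalIntegral_of_continuousOn ?_
  filter_upwards [hl.eventually_mem self_mem_nhdsWithin] with i hi
  rw [uIcc_of_le hT]
  exact hf.comp (f := fun s => ((l i, u i s), s))
    ((continuousOn_const.prodMk (hu_cont i)).prodMk continuousOn_id)
    fun s hs => ⟨⟨hi, mem_univ _⟩, hs⟩

end SmallParameter

theorem mainTheorem8_general [CompleteSpace E] {A : E →ₗ.[ℝ] E}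
    (hAS : IsInfinitesimalGenerator (-A) S) {T : ℝ} (hT : 0 < T) {F : ℝ → E → E}
    (hFcont : ContinuousOn (fun p : ℝ × E => F p.1 p.2) (Icc 0 T ×ˢ univ))
    {U : Set E} {x₀ : E} (hx₀ : IsBranchingPoint S F T U x₀) :
    ∃ h : x₀ ∈ A.domain, -(A ⟨x₀, h⟩) + timeAverage F T x₀ = 0 := by
  obtain ⟨-, xs, ls, hper, hlim⟩ := hx₀
  choose u hu hclosed using fun n => (hper n).2.2
  have hxs : Tendsto xs atTop (𝓝 x₀) := hlim.fst_nhds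
  have hls : Tendsto ls atTop (𝓝[≥] 0) :=
    tendsto_nhdsWithin_iff.2 ⟨hlim.snd_nhds, .of_forall fun n => (hper n).2.1.le⟩
  have hperiod : Tendsto (fun n => ls n * T) atTop (𝓝[>] 0) :=
    tendsto_nhdsWithin_iff.2 ⟨by simpa using hlim.snd_nhds.mul_const T,
      .of_forall fun n => mul_pos (hper n).2.1 hT⟩
  have hunif := tendstoUniformlyOn_of_isMildSolution hAS.semigroup hFcont hls hxs hu
  have hint := tendsto_duhamel_integral hAS.semigroup hT.le hFcont hls
    (fun n => (hu n).continuousOn) hunif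
  have hquot : Tendsto (fun n => (ls n * T)⁻¹ • (S (ls n * T) (xs n) - xs n)) atTop
      (𝓝 (-timeAverage F T x₀)) :=
    (hint.const_smul (1 / T)).neg.congr fun n =>
      ((hu n).inv_smul_sub_eq_neg_of_eq hT.le (hper n).2.1.ne' (hclosed n)).symm
  obtain ⟨hdom, hval⟩ := (hAS.generator x₀ _).2
    (hAS.semigroup.tendsto_differenceQuotient hperiod hxs hquot)
  exact ⟨hdom, eq_neg_iff_add_eq_zero.1 hval⟩

end C0Semigroup

theorem mainTheorem8 {E : Type*} [NormedAddCommGroup E] [NormedSpace ℝ E] [CompleteSpace E]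
    [TopologicalSpace.SeparableSpace E]
    (A : E →ₗ.[ℝ] E) (hA : Dense (A.domain : Set E))
    (S : ℝ → E →L[ℝ] E) (hAS : IsInfinitesimalGenerator (-A) S)
    (ω : ℝ) (hω : 0 < ω) (hS : ∀ t : ℝ, 0 ≤ t → ‖S t‖ ≤ Real.exp (-ω * t))
    (T : ℝ) (hT : 0 < T)
    (F : ℝ → E → E)
    (hFcont : ContinuousOn (fun p : ℝ × E => F p.1 p.2) (Icc 0 T ×ˢ univ))
    (hFlip : ∀ x : E, ∃ δ > 0, ∃ L > 0, ∀ x₁ ∈ Metric.ball x δ, ∀ x₂ ∈ Metric.ball x δ,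
      ∀ t ∈ Icc (0 : ℝ) T, ‖F t x₁ - F t x₂‖ ≤ L * ‖x₁ - x₂‖)
    (hFgrowth : ∃ c > 0, ∀ t ∈ Icc (0 : ℝ) T, ∀ x : E, ‖F t x‖ ≤ c * (1 + ‖x‖))
    (hFk : ∃ k : ℝ, 0 ≤ k ∧ k < ω ∧ ∀ Ω : Set E, Bornology.IsBounded Ω →
      hausdorffMNC ((fun p : ℝ × E => F p.1 p.2) '' (Icc 0 T ×ˢ Ω)) ≤
        ENNReal.ofReal k * hausdorffMNC Ω)
    (U : Set E) (hUopen : IsOpen U) (hUbdd : Bornology.IsBounded U)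
    (x₀ : E) (hx₀ : IsBranchingPoint S F T U x₀) :
    ∃ h : x₀ ∈ A.domain, -(A ⟨x₀, h⟩) + timeAverage F T x₀ = 0 :=
  mainTheorem8_general hAS hT hFcont hx₀
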